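/- Let $\mathbf k$ be a commutative $\mathbb Q$-algebra, $Y=\{y_n\}_{n\ge1}$ an alphabet, and $\mathcal H_{\rm stuffle}=(\mathbf k\langle Y\rangle,\cdot,1,\Delta)$ the free associative algebra on $Y$ with the coproduct $\Delta=\Delta_{\rm stuffle}$, the morphism of algebras $\mathbf k\langle Y\rangle\to\mathbf k\langle Y\rangle\otimes\mathbf k\langle Y\rangle$ defined on letters by $$\Delta y_n=y_n\otimes1+1\otimes y_n+\sum_{i=1}^{n-1}y_i\otimes y_{n-i}.$$ Let $\mathrm{Prim}(\mathcal H_{\rm stuffle})=\{P\mid\Delta P=P\otimes1+1\otimes P\}$, a Lie algebra for the commutator bracket. In $\mathbf k\langle Y\rangle[[t]]$, with $t$ central, put $\mathcal Y(t)=1+\sum_{n\ge1}y_nt^n$, let $\dot{\mathcal Y}=d\mathcal Y/dt$, and define $R_n,L_n\in\mathbf k\langle Y\rangle$ for $n\ge1$ by $$\mathcal Y^{-1}\dot{\mathcal Y}=\sum_{n\ge1}R_nt^{n-1},\qquad \dot{\mathcal Y}\mathcal Y^{-1}=\sum_{n\ge1}L_nt^{n-1}.$$ For a composition $J=(j_1,\dots,j_p)$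 with weight $w(J)=j_1+\dots+j_p$ and length $l(J)=p$, write $R^J=R_{j_1}\cdots R_{j_p}$, $L^{\tilde J}=L_{j_p}\cdots L_{j_1}$ and $\pi_u(J)=j_1(j_1+j_2)\cdots(j_1+\dots+j_p)$. Then: 1. For all $n\ge1$, $R_n$ and $L_n$ are primitive for $\Delta_{\rm stuffle}$. 2. The Lie $\mathbf k$-algebra generated by $\{R_n\}_{n\ge1}$, and likewise the one generated by $\{L_n\}_{n\ge1}$, equals $\mathrm{Prim}(\mathcal H_{\rm stuffle})$. 3. The letters are triangular in the $R$'s and in the $L$'s: for all $n\ge1$, $$y_n=\sum_{w(J)=n}\frac{R^J}{\pi_u(J)}=\frac{R_n}n+\sum_{w(J)=n,\;l(J)>1}\frac{R^J}{\pi_u(J)},\qquad y_n=\sum_{w(J)=n}\frac{L^{\tilde J}}{\pi_u(J)}=\frac{L_n}n+\sum_{w(J)=n,\;l(J)>1}\frac{L^{\tilde J}}{\pi_u(J)}.$$ -/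

import Mathlib

open scoped TensorProduct

attribute [local instance] LieRing.ofAssociativeRing

namespace Stuffle

noncomputable section

/-- The algebra `k⟨Y⟩` of noncommutative polynomials over the alphabet `Y = {y_i}_{i ≥ 1}`,
with the concatenation product; its commutator bracket is Mathlib's `LieRing.ofAssociativeRing`. -/
abbrev NCPoly (k : Type*) [CommRing k] : Type _ := FreeAlgebra k ℕ+

/-- The letter `y_n` for `n ≥ 1`, with the convention `y_0 = 1`. -/
def y (k : Type*) [CommRing k] (n : ℕ) : NCPoly k :=
  if h : 0 < n then FreeAlgebra.ι k (⟨n, h⟩ : ℕ+) else 1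

/-- The coproduct `Δ_stuffle`: the morphism of algebras (for concatenation) given on letters by
`Δ y_n = y_n ⊗ 1 + 1 ⊗ y_n + ∑_{i=1}^{n-1} y_i ⊗ y_{n-i}`. -/
def coproduct (k : Type*) [CommRing k] : NCPoly k →ₐ[k] NCPoly k ⊗[k] NCPoly k :=
  FreeAlgebra.lift k fun n : ℕ+ =>
    FreeAlgebra.ι k n ⊗ₜ[k] 1 + 1 ⊗ₜ[k] FreeAlgebra.ι k n
      + ∑ i ∈ Finset.Ico 1 (n : ℕ), y k i ⊗ₜ[k] y k ((n : ℕ) - i)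

/-- `P` is primitive for `Δ_stuffle`. -/
def IsPrimitive (k : Type*) [CommRing k] (P : NCPoly k) : Prop :=
  coproduct k P = P ⊗ₜ[k] 1 + 1 ⊗ₜ[k] P

/-- `Prim(H_stuffle)`, the Lie algebra (for the commutator) of all primitive elements. -/
def Prim (k : Type*) [CommRing k] : LieSubalgebra k (NCPoly k) where
  carrier := {P | IsPrimitive k P}
  add_mem' := by
    intro P Q hP hQ
    change coproduct k P = _ at hP
    change coproduct k Q = _ at hQ
    change coproduct k (P + Q) = (P + Q) ⊗ₜ[k] 1 + 1 ⊗ₜ[k] (P + Q)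
    rw [map_add, hP, hQ, TensorProduct.add_tmul, TensorProduct.tmul_add]
    abel
  zero_mem' := by simp [IsPrimitive]
  smul_mem' := by
    intro c P hP
    change coproduct k P = _ at hP
    change coproduct k (c • P) = (c • P) ⊗ₜ[k] 1 + 1 ⊗ₜ[k] (c • P)
    rw [map_smul, hP, smul_add, TensorProduct.smul_tmul', TensorProduct.tmul_smul]
  lie_mem' := by
    intro P Q hP hQ
    change coproduct k P = _ at hP
    change coproduct k Q = _ at hQ
    change coproduct k ⁅P, Q⁆ = ⁅P, Q⁆ ⊗ₜ[k] 1 + 1 ⊗ₜ[k] ⁅P, Q⁆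
    rw [Ring.lie_def, map_sub, map_mul, map_mul, hP, hQ]
    simp only [mul_add, add_mul, Algebra.TensorProduct.tmul_mul_tmul, mul_one, one_mul,
      TensorProduct.sub_tmul, TensorProduct.tmul_sub]
    abel

/-- The generating series `𝒴(t) = 1 + ∑_{n ≥ 1} y_n t^n` in `k⟨Y⟩⟦t⟧` (`t` is central). -/
def ySeries (k : Type*) [CommRing k] : PowerSeries (NCPoly k) :=
  PowerSeries.mk fun n => y k n

theorem constantCoeff_ySeries (k : Type*) [CommRing k] :
    PowerSeries.constantCoeff (ySeries k) = ((1 : (NCPoly k)ˣ) : NCPoly k) := by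
  simp [ySeries, y, ← PowerSeries.coeff_zero_eq_constantCoeff_apply]

/-- The inverse series `𝒴⁻¹`; it is a two-sided inverse by the two facts that follow. -/
def ySeriesInv (k : Type*) [CommRing k] : PowerSeries (NCPoly k) :=
  PowerSeries.invOfUnit (ySeries k) 1

theorem ySeries_mul_ySeriesInv (k : Type*) [CommRing k] : ySeries k * ySeriesInv k = 1 :=
  PowerSeries.mul_invOfUnit _ _ (constantCoeff_ySeries k)

theorem ySeriesInv_mul_ySeries (k : Type*) [CommRing k] : ySeriesInv k * ySeries k = 1 :=
  PowerSeries.invOfUnit_mul _ _ (constantCoeff_ySeries k)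

/-- The formal derivative `d/dt` of a power series over a possibly noncommutative ring:
`∑ a_n t^n ↦ ∑ (n+1) a_{n+1} t^n`. -/
def dot {A : Type*} [Ring A] (f : PowerSeries A) : PowerSeries A :=
  PowerSeries.mk fun n => (n + 1) • PowerSeries.coeff (n + 1) f

/-- `R = 𝒴⁻¹ 𝒴̇`. -/
def rSeries (k : Type*) [CommRing k] : PowerSeries (NCPoly k) :=
  ySeriesInv k * dot (ySeries k)

/-- `L = 𝒴̇ 𝒴⁻¹`. -/
def lSeries (k : Type*) [CommRing k] : PowerSeries (NCPoly k) :=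
  dot (ySeries k) * ySeriesInv k

/-- `R_n` for `n ≥ 1`, where `R(t) = ∑_{n ≥ 1} R_n t^{n-1}` (the value at `n = 0` is not used). -/
def R (k : Type*) [CommRing k] (n : ℕ) : NCPoly k := PowerSeries.coeff (n - 1) (rSeries k)

/-- `L_n` for `n ≥ 1`, where `L(t) = ∑_{n ≥ 1} L_n t^{n-1}` (the value at `n = 0` is not used). -/
def L (k : Type*) [CommRing k] (n : ℕ) : NCPoly k := PowerSeries.coeff (n - 1) (lSeries k)

/-- `π_u(J) = j_1 (j_1 + j_2) ⋯ (j_1 + ⋯ + j_p)` for a composition `J = (j_1, …, j_p)`. -/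
def piU {n : ℕ} (J : Composition n) : ℕ := ∏ i : Fin J.length, J.sizeUpTo (i + 1)

/-- `S^J = S_{j_1} S_{j_2} ⋯ S_{j_p}` for a composition `J = (j_1, …, j_p)`. -/
def compProd {A : Type*} [Ring A] (S : ℕ → A) {n : ℕ} (J : Composition n) : A :=
  (J.blocks.map S).prod

/-- `S^{J̃} = S_{j_p} ⋯ S_{j_2} S_{j_1}`, the product along the mirror image of `J`. -/
def compProdMirror {A : Type*} [Ring A] (S : ℕ → A) {n : ℕ} (J : Composition n) : A :=
  (J.blocks.reverse.map S).prod

end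

end Stuffle

/-! The stuffle formula says that `𝒴(t)` is group-like, so by the Leibniz rule its two logarithmic
derivatives are primitive (`map_coproduct_rSeries`, `map_coproduct_lSeries`). Comparing coefficients
in `𝒴 R = 𝒴̇` gives `n yₙ = ∑_{i<n} yᵢ R_{n-i}`. Solving this by removing last parts of compositions
yields the expansion with denominators `π_u` (`eq_compSum`); the `L` case is the same argument in
the opposite algebra.

For Lie generation, the expansions show that the `Rₙ` generate the algebra. An endomorphism `ψ` with
`ψ(Rₙ) = yₙ` carries the stuffle coproduct to the one with primitive letters. Hence `ψ` sends a
stuffle-primitive `P` to a primitive element in the ordinary sense, which is a Lie polynomial in the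
letters by Friedrichs' theorem (`mem_lieSpan_of_primitive`). Substituting `Rₙ` for `yₙ` recovers `P`
(`lieSpan_eq_Prim`).

Friedrichs' theorem comes from the Dynkin operator `D`: the convolution of `D` with the identity is
multiplication by length, and on a primitive element it reduces to `D`. -/

namespace FreeAlgebra

/-! ### Friedrichs' theorem through the Dynkin operator. -/

noncomputable section

variable {k : Type*} [CommRing k] {X : Type*}

variable (k X) in
/-- The coproduct of the free algebra for which all generators are primitive. -/
def primitiveCoproduct : FreeAlgebra k X →ₐ[k] FreeAlgebra k X ⊗[k] FreeAlgebra k X :=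
  lift k fun x => ι k x ⊗ₜ[k] 1 + 1 ⊗ₜ[k] ι k x

@[simp]
theorem primitiveCoproduct_ι (x : X) :
    primitiveCoproduct k X (ι k x) = ι k x ⊗ₜ[k] 1 + 1 ⊗ₜ[k] ι k x := by
  simp [primitiveCoproduct]

variable (k) in
/-- The monomial attached to a list of generators. -/
def word (l : List X) : FreeAlgebra k X := (l.map (ι k)).prod

@[simp] theorem word_nil : word k ([] : List X) = 1 := rfl

@[simp]
theorem word_cons (x : X) (l : List X) : word k (x :: l) = ι k x * word k l := by simp [word]

theorem basisFreeMonoid_ofList (l : List X) :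
    basisFreeMonoid k X (FreeMonoid.ofList l) = word k l := by
  have h : basisFreeMonoid k X (FreeMonoid.ofList l) =
      equivMonoidAlgebraFreeMonoid.symm (MonoidAlgebra.of k _ (FreeMonoid.ofList l)) := rfl
  rw [h]
  induction l with
  | nil => simpa using MonoidAlgebra.one_def.symm
  | cons x l ih =>
    rw [FreeMonoid.ofList_cons, map_mul, map_mul, ih ?_, word_cons]
    · simp [equivMonoidAlgebraFreeMonoid]
    · rfl

/-- Two linear maps that agree on all monomials are equal. -/
theorem linearMap_ext_word {M : Type*} [AddCommMonoid M] [Module k M]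
    {f g : FreeAlgebra k X →ₗ[k] M} (h : ∀ l, f (word k l) = g (word k l)) : f = g :=
  (basisFreeMonoid k X).ext fun w => by
    simpa only [← basisFreeMonoid_ofList, FreeMonoid.ofList_toList] using h w.toList

theorem span_range_word : Submodule.span k (Set.range (word k (X := X))) = ⊤ := by
  rw [← (basisFreeMonoid k X).span_eq]
  congr 1
  ext a
  constructor
  · rintro ⟨l, rfl⟩
    exact ⟨_, basisFreeMonoid_ofList l⟩
  · rintro ⟨w, rfl⟩
    exact ⟨w.toList, by rw [← basisFreeMonoid_ofList, FreeMonoid.ofList_toList]⟩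

variable (k X) in
/-- The representation of the free algebra on `k⟨X⟩ × k` in which a generator `x` acts by
`(a, c) ↦ (⁅x, a⁆ + c x, 0)`. -/
def dynkinRep : FreeAlgebra k X →ₐ[k] Module.End k (FreeAlgebra k X × k) :=
  lift k fun x => LinearMap.inl k (FreeAlgebra k X) k ∘ₗ
    (LinearMap.mulLeft k (ι k x) - LinearMap.mulRight k (ι k x)).coprod
      (LinearMap.toSpanSingleton k _ (ι k x))

theorem dynkinRep_ι (x : X) (v : FreeAlgebra k X × k) :
    dynkinRep k X (ι k x) v = (ι k x * v.1 - v.1 * ι k x + v.2 • ι k x, 0) := by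
  simp [dynkinRep]

/-- Every generator kills the second coordinate, so only the constant term acts on it. This makes
the innermost letter of a word enter as itself and the outer ones as commutators. -/
theorem dynkinRep_snd (w : FreeAlgebra k X) (v : FreeAlgebra k X × k) :
    (dynkinRep k X w v).2 = algebraMapInv w * v.2 := by
  induction w using FreeAlgebra.induction generalizing v with
  | grade0 r => simp [Module.algebraMap_end_apply]
  | grade1 x => simp [dynkinRep_ι, algebraMapInv]
  | mul a b ha hb => simp [ha, hb, mul_assoc]
  | add a b ha hb => simp [ha, hb, add_mul]

variable (k X) in
/-- The Dynkin operator, `x₁ ⋯ xₙ ↦ ⁅x₁, ⁅x₂, … xₙ⁆⁆`, which vanishes at `1`. -/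
def dynkin : FreeAlgebra k X →ₗ[k] FreeAlgebra k X :=
  LinearMap.fst k _ _ ∘ₗ LinearMap.applyₗ (0, 1) ∘ₗ (dynkinRep k X).toLinearMap

theorem dynkin_apply (w : FreeAlgebra k X) : dynkin k X w = (dynkinRep k X w (0, 1)).1 := rfl

@[simp] theorem dynkin_one : dynkin k X 1 = 0 := by simp [dynkin_apply]

theorem dynkin_ι_mul (x : X) (w : FreeAlgebra k X) :
    dynkin k X (ι k x * w) =
      ι k x * dynkin k X w - dynkin k X w * ι k x + (algebraMapInv w : k) • ι k x := by
  simp [dynkin_apply, dynkinRep_ι, dynkinRep_snd]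

/-- `a ⊗ b ↦ D(a) b` for the Dynkin operator `D`. -/
def dynkinMul : FreeAlgebra k X ⊗[k] FreeAlgebra k X →ₗ[k] FreeAlgebra k X :=
  LinearMap.mul' k _ ∘ₗ (dynkin k X).rTensor _

@[simp]
theorem dynkinMul_tmul (a b : FreeAlgebra k X) : dynkinMul (a ⊗ₜ[k] b) = dynkin k X a * b := by
  simp [dynkinMul]

/-- `a ⊗ b ↦ ε(a) b` for the augmentation `ε`. -/
def counitMul : FreeAlgebra k X ⊗[k] FreeAlgebra k X →ₐ[k] FreeAlgebra k X :=
  Algebra.TensorProduct.lift ((Algebra.ofId k _).comp algebraMapInv) (AlgHom.id k _)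
    fun a b => by
      rw [AlgHom.comp_apply, Algebra.ofId_apply]
      exact Algebra.commute_algebraMap_left _ _

@[simp]
theorem counitMul_tmul (a b : FreeAlgebra k X) :
    counitMul (a ⊗ₜ[k] b) = (algebraMapInv a : k) • b := by
  simp [counitMul, Algebra.ofId_apply, Algebra.smul_def]

theorem counitMul_primitiveCoproduct (w : FreeAlgebra k X) :
    counitMul (primitiveCoproduct k X w) = w := by
  have h : counitMul.comp (primitiveCoproduct k X) = AlgHom.id k _ := by
    ext x
    simp [algebraMapInv]
  exact DFunLike.congr_fun h w

/-- On `a ⊗ b`, the term `-D(a) x b` of the commutator cancels against the contribution of `1 ⊗ x`.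
-/
theorem dynkinMul_ι_mul (x : X) (z : FreeAlgebra k X ⊗[k] FreeAlgebra k X) :
    dynkinMul ((ι k x ⊗ₜ[k] 1 + 1 ⊗ₜ[k] ι k x) * z) =
      ι k x * dynkinMul z + ι k x * counitMul z := by
  induction z with
  | zero => simp
  | add a b ha hb => rw [mul_add, map_add, ha, hb]; simp only [map_add, mul_add]; abel
  | tmul a b =>
    simp only [add_mul, Algebra.TensorProduct.tmul_mul_tmul, one_mul, map_add, dynkinMul_tmul,
      dynkin_ι_mul, counitMul_tmul, sub_mul, mul_assoc, smul_mul_assoc, mul_smul_comm]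
    abel

/-- The convolution of the Dynkin operator with the identity multiplies a monomial by its length. -/
theorem dynkinMul_primitiveCoproduct_word (l : List X) :
    dynkinMul (primitiveCoproduct k X (word k l)) = (l.length : k) • word k l := by
  induction l with
  | nil => simp [Algebra.TensorProduct.one_def]
  | cons x l ih =>
    rw [word_cons, map_mul, primitiveCoproduct_ι, dynkinMul_ι_mul, ih,
      counitMul_primitiveCoproduct]
    simp [add_smul]

variable (k X) in
/-- The span of the monomials of length `n`. -/
def homogeneous (n : ℕ) : Submodule k (FreeAlgebra k X) :=
  Submodule.span k (word k '' {l | l.length = n})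

theorem word_append (l m : List X) : word k (l ++ m) = word k l * word k m := by simp [word]

theorem ι_mul_mem_homogeneous (x : X) {n : ℕ} {a : FreeAlgebra k X}
    (ha : a ∈ homogeneous k X n) : ι k x * a ∈ homogeneous k X (n + 1) := by
  refine Submodule.span_le (p := (homogeneous k X (n + 1)).comap
    (LinearMap.mulLeft k (ι k x))).2 ?_ ha
  rintro _ ⟨l, rfl, rfl⟩
  exact Submodule.subset_span ⟨x :: l, by simp⟩

theorem mul_ι_mem_homogeneous (x : X) {n : ℕ} {a : FreeAlgebra k X}
    (ha : a ∈ homogeneous k X n) : a * ι k x ∈ homogeneous k X (n + 1) := by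
  refine Submodule.span_le (p := (homogeneous k X (n + 1)).comap
    (LinearMap.mulRight k (ι k x))).2 ?_ ha
  rintro _ ⟨l, rfl, rfl⟩
  exact Submodule.subset_span ⟨l ++ [x], by simp [word_append]⟩

theorem dynkin_word_mem_homogeneous (l : List X) :
    dynkin k X (word k l) ∈ homogeneous k X l.length := by
  induction l with
  | nil => simp
  | cons x l ih =>
    rw [word_cons, dynkin_ι_mul]
    refine add_mem (sub_mem (ι_mul_mem_homogeneous x ih) (mul_ι_mem_homogeneous x ih)) ?_
    cases l with
    | nil => exact Submodule.smul_mem _ _ (Submodule.subset_span ⟨[x], by simp⟩)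
    | cons z l => simp [algebraMapInv]

theorem dynkin_word_mem_lieSpan (l : List X) :
    dynkin k X (word k l) ∈ LieSubalgebra.lieSpan k (FreeAlgebra k X) (Set.range (ι k)) := by
  induction l with
  | nil => simp
  | cons x l ih =>
    have hx := LieSubalgebra.subset_lieSpan (R := k) (L := FreeAlgebra k X)
      (Set.mem_range_self (f := ι k) x)
    rw [word_cons, dynkin_ι_mul]
    exact add_mem (LieSubalgebra.lie_mem _ hx ih) (SMulMemClass.smul_mem _ hx)

variable [Algebra ℚ k]

variable (k X) in
/-- Division of every nonempty monomial by its length. -/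
def divLength : FreeAlgebra k X →ₗ[k] FreeAlgebra k X :=
  (basisFreeMonoid k X).constr k fun w =>
    algebraMap ℚ k (w.toList.length : ℚ)⁻¹ • basisFreeMonoid k X w

theorem divLength_word (l : List X) :
    divLength k X (word k l) = algebraMap ℚ k (l.length : ℚ)⁻¹ • word k l := by
  rw [← basisFreeMonoid_ofList, divLength, Module.Basis.constr_basis, FreeMonoid.toList_ofList]

theorem divLength_of_mem_homogeneous {n : ℕ} {a : FreeAlgebra k X} (ha : a ∈ homogeneous k X n) :
    divLength k X a = algebraMap ℚ k (n : ℚ)⁻¹ • a := by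
  refine Submodule.span_le (p := LinearMap.eqLocus (divLength k X)
    (algebraMap ℚ k (n : ℚ)⁻¹ • LinearMap.id)).2 ?_ ha
  rintro _ ⟨l, rfl, rfl⟩
  exact divLength_word l

theorem divLength_dynkinMul_primitiveCoproduct (a : FreeAlgebra k X) :
    divLength k X (dynkinMul (primitiveCoproduct k X a)) =
      a - algebraMap k _ (algebraMapInv a) := by
  have h : divLength k X ∘ₗ dynkinMul ∘ₗ (primitiveCoproduct k X).toLinearMap =
      LinearMap.id - Algebra.linearMap k _ ∘ₗ
        (algebraMapInv : FreeAlgebra k X →ₐ[k] k).toLinearMap := by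
    refine linearMap_ext_word fun l => ?_
    simp only [LinearMap.comp_apply, AlgHom.toLinearMap_apply,
      dynkinMul_primitiveCoproduct_word, map_smul, divLength_word, smul_smul]
    cases l with
    | nil => simp
    | cons x l =>
      -- A nonempty word has positive length, invertible because `k` is a `ℚ`-algebra.
      have : ((x :: l).length : k) * algebraMap ℚ k ((x :: l).length : ℚ)⁻¹ = 1 := by
        rw [← map_natCast (algebraMap ℚ k), ← map_mul, mul_inv_cancel₀, map_one]
        simp only [List.length_cons]
        positivity
      rw [this]
      simp [algebraMapInv]
  exact DFunLike.congr_fun h a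

/-- `D` preserves length, so on `D` of a word the division is multiplication by a scalar and stays
in the Lie span. -/
theorem divLength_dynkin_mem_lieSpan (a : FreeAlgebra k X) :
    divLength k X (dynkin k X a) ∈
      LieSubalgebra.lieSpan k (FreeAlgebra k X) (Set.range (ι k)) := by
  have ha : a ∈ Submodule.span k (Set.range (word k (X := X))) := by
    rw [span_range_word]
    trivial
  refine Submodule.span_le (p := (LieSubalgebra.lieSpan k (FreeAlgebra k X)
    (Set.range (ι k))).toSubmodule.comap (divLength k X ∘ₗ dynkin k X)).2 ?_ ha
  rintro _ ⟨l, rfl⟩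
  change divLength k X (dynkin k X (word k l)) ∈ LieSubalgebra.lieSpan k _ _
  rw [divLength_of_mem_homogeneous (dynkin_word_mem_homogeneous l)]
  exact SMulMemClass.smul_mem _ (dynkin_word_mem_lieSpan l)

/-- **Friedrichs' theorem**: the primitive elements of a free algebra over a commutative
`ℚ`-algebra are Lie polynomials. -/
theorem mem_lieSpan_of_primitive {a : FreeAlgebra k X}
    (ha : primitiveCoproduct k X a = a ⊗ₜ[k] 1 + 1 ⊗ₜ[k] a) :
    a ∈ LieSubalgebra.lieSpan k (FreeAlgebra k X) (Set.range (ι k)) := by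
  have hε : algebraMap k (FreeAlgebra k X) (algebraMapInv a) = 0 := by
    have h := counitMul_primitiveCoproduct a
    rw [ha] at h
    -- The identity reads `ε(a) 1 + a = a`.
    simpa [Algebra.algebraMap_eq_smul_one] using h
  have h := divLength_dynkinMul_primitiveCoproduct a
  rw [hε, ha, sub_zero] at h
  rw [← h]
  -- Since `D(1) = 0`, the convolution applied to `a ⊗ 1 + 1 ⊗ a` is `D(a)`.
  simpa using divLength_dynkin_mem_lieSpan a

end

end FreeAlgebra

/-! ### Sums over compositions and their recursion. -/

namespace Stuffle

noncomputable section

theorem piU_eq_prod_range {n : ℕ} (J : Composition n) :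
    piU J = ∏ i ∈ Finset.range J.length, (J.blocks.take (i + 1)).sum := by
  rw [piU, Finset.prod_range]
  rfl

theorem piU_append_single {n m : ℕ} (J : Composition n) (hm : 0 < m) :
    piU (J.append (Composition.single m hm)) = piU J * (n + m) := by
  have hl : (J.append (Composition.single m hm)).length = J.length + 1 := by
    simp [Composition.length]
  rw [piU_eq_prod_range, piU_eq_prod_range, hl, Finset.prod_range_succ]
  congr 1
  · refine Finset.prod_congr rfl fun i hi => ?_
    rw [Composition.append_blocks, List.take_append_of_le_length]
    exact Nat.succ_le_of_lt (Finset.mem_range.1 hi)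
  · rw [List.take_of_length_le (by simp [Composition.length]), Composition.blocks_sum]

theorem compProd_append_single {A : Type*} [Ring A] (S : ℕ → A) {n m : ℕ} (J : Composition n)
    (hm : 0 < m) :
    compProd S (J.append (Composition.single m hm)) = compProd S J * S m := by
  simp [compProd]

/-- Removal of the last part of a composition. -/
theorem bijective_append_single (n : ℕ) :
    Function.Bijective fun p : (Σ i : Fin (n + 1), Composition i) =>
      (p.2.append (Composition.single (n + 1 - p.1) (by omega))).cast
        (show (p.1 : ℕ) + (n + 1 - p.1) = n + 1 by omega) := by
  constructor
  · rintro ⟨⟨i, hi⟩, J⟩ ⟨⟨j, hj⟩, K⟩ h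
    have hb := congrArg Composition.blocks h
    simp only [Composition.cast_blocks, Composition.append_blocks, Composition.single_blocks] at hb
    obtain ⟨hb, -⟩ := List.append_inj' hb rfl
    obtain rfl : i = j := J.blocks_sum.symm.trans ((congrArg List.sum hb).trans K.blocks_sum)
    obtain rfl := Composition.ext hb
    rfl
  · intro J
    -- The weight is generalized to `m` so that induction on the last part applies.
    have key : ∀ m (J : Composition m), m = n + 1 → ∃ p : (Σ i : Fin (n + 1), Composition i),
        p.2.blocks ++ [n + 1 - p.1] = J.blocks := by
      intro m J
      induction J using Composition.recOnAppendSingle with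
      | zero => intro h; omega
      | append_single l i c _ =>
        intro h
        refine ⟨⟨⟨i, by omega⟩, c⟩, ?_⟩
        simp [show n + 1 - i = l + 1 by omega]
    obtain ⟨p, hp⟩ := key _ J rfl
    exact ⟨p, Composition.ext (by simpa using hp)⟩

variable {A : Type*} [Ring A] [Algebra ℚ A]

/-- The sum `∑_{w(J) = n} S^J / π_u(J)`. -/
def compSum (S : ℕ → A) (n : ℕ) : A :=
  ∑ J : Composition n, (piU J : ℚ)⁻¹ • compProd S J

theorem compSum_zero (S : ℕ → A) : compSum S 0 = 1 := by
  have h (J : Composition 0) : J.blocks = [] :=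
    List.length_eq_zero_iff.1 (by simp)
  have : Subsingleton (Composition 0) := ⟨fun J K => Composition.ext ((h J).trans (h K).symm)⟩
  rw [compSum, Fintype.sum_subsingleton _ (Composition.ones 0)]
  simp [piU_eq_prod_range, compProd]

/-- The last factor of `π_u(J)` is the full weight `n + 1`, which cancels; what remains is indexed
by `J` without its last part. -/
theorem natCast_smul_compSum_succ (S : ℕ → A) (n : ℕ) :
    (n + 1) • compSum S (n + 1) =
      ∑ i ∈ Finset.range (n + 1), compSum S i * S (n + 1 - i) := by
  rw [compSum, ← (bijective_append_single n).sum_comp, Fintype.sum_sigma, Finset.sum_range,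
    Finset.smul_sum]
  refine Finset.sum_congr rfl fun i _ => ?_
  rw [compSum, Finset.sum_mul, Finset.smul_sum]
  refine Finset.sum_congr rfl fun J _ => ?_
  have h1 : piU ((J.append (Composition.single (n + 1 - i) (by omega))).cast
      (show (i : ℕ) + (n + 1 - i) = n + 1 by omega)) = piU J * (n + 1) :=
    (piU_append_single J (by omega)).trans (by congr 1; omega)
  have h2 : compProd S ((J.append (Composition.single (n + 1 - i) (by omega))).cast
      (show (i : ℕ) + (n + 1 - i) = n + 1 by omega)) = compProd S J * S (n + 1 - i) :=
    compProd_append_single S J (by omega)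
  rw [h1, h2, ← Nat.cast_smul_eq_nsmul ℚ, smul_smul, smul_mul_assoc]
  congr 1
  have : ((n + 1 : ℕ) : ℚ) ≠ 0 := by positivity
  push_cast at this ⊢
  rw [mul_inv, mul_left_comm, mul_inv_cancel₀ this, mul_one]

/-- A sequence with `z₀ = 1` and `n zₙ = ∑_{i < n} zᵢ S_{n-i}` is given by `compSum S`. -/
theorem eq_compSum (S z : ℕ → A) (h0 : z 0 = 1)
    (hz : ∀ n, (n + 1) • z (n + 1) = ∑ i ∈ Finset.range (n + 1), z i * S (n + 1 - i)) (n : ℕ) :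
    z n = compSum S n := by
  induction n using Nat.strong_induction_on with
  | _ n ih =>
    cases n with
    | zero => rw [h0, compSum_zero]
    | succ n =>
      have h : (n + 1) • z (n + 1) = (n + 1) • compSum S (n + 1) := by
        rw [hz, natCast_smul_compSum_succ]
        exact Finset.sum_congr rfl fun i hi => by rw [ih i (Finset.mem_range.1 hi)]
      rw [← Nat.cast_smul_eq_nsmul ℚ, ← Nat.cast_smul_eq_nsmul ℚ] at h
      exact smul_right_injective A (by positivity) h

/-- The recursion determines `S` in positive degrees. -/
theorem eq_of_recursion {A : Type*} [Ring A] {S T z : ℕ → A} (h0 : z 0 = 1)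
    (hST : ∀ n, ∑ i ∈ Finset.range (n + 1), z i * S (n + 1 - i) =
      ∑ i ∈ Finset.range (n + 1), z i * T (n + 1 - i)) {n : ℕ} (hn : 1 ≤ n) : S n = T n := by
  induction n using Nat.strong_induction_on with
  | _ n ih =>
    obtain ⟨n, rfl⟩ := Nat.exists_eq_add_of_le' hn
    have h := hST n
    -- The term `i = 0` isolates `S (n + 1)`; all others involve smaller indices.
    rw [Finset.sum_range_succ', Finset.sum_range_succ', h0, one_mul, one_mul] at h
    rw [Finset.sum_congr rfl fun i hi => by
      rw [ih (n + 1 - (i + 1)) (by omega) (by have := Finset.mem_range.1 hi; omega)]] at h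
    simpa using h

theorem compSum_eq_add (S : ℕ → A) {n : ℕ} (hn : 1 ≤ n) :
    compSum S n = (n : ℚ)⁻¹ • S n +
      ∑ J : Composition n with 1 < J.length, (piU J : ℚ)⁻¹ • compProd S J := by
  rw [compSum, ← Finset.sum_filter_add_sum_filter_not _ (fun J : Composition n => 1 < J.length),
    add_comm]
  congr 1
  have hf : (Finset.univ.filter fun J : Composition n => ¬ 1 < J.length) =
      {Composition.single n hn} := by
    ext J
    have := J.length_pos_of_pos hn
    simp only [Finset.mem_filter, Finset.mem_univ, true_and, Finset.mem_singleton,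
      Composition.eq_single_iff_length hn]
    omega
  rw [hf, Finset.sum_singleton]
  simp [piU_eq_prod_range, compProd, Composition.length]

theorem unop_compProd_op {A : Type*} [Ring A] (S : ℕ → A) {n : ℕ} (J : Composition n) :
    (compProd (fun i => MulOpposite.op (S i)) J).unop = compProdMirror S J := by
  rw [compProd, compProdMirror, MulOpposite.unop_list_prod, List.map_map, List.map_reverse]
  rfl

theorem unop_compSum_op (S : ℕ → A) (n : ℕ) :
    (compSum (fun i => MulOpposite.op (S i)) n).unop =
      ∑ J : Composition n, (piU J : ℚ)⁻¹ • compProdMirror S J := by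
  simp [compSum, ← unop_compProd_op, Finset.unop_sum]

end

end Stuffle

/-! ### Logarithmic derivatives of the group-like series. -/

namespace Stuffle

noncomputable section

open PowerSeries Finset.HasAntidiagonal

theorem dot_mul {A : Type*} [Ring A] (f g : A⟦X⟧) : dot (f * g) = dot f * g + f * dot g := by
  ext n
  simp only [dot, coeff_mk, coeff_mul, map_add]
  have h1 : (n + 1) • ∑ p ∈ antidiagonal (n + 1), coeff p.1 f * coeff p.2 g =
      ∑ p ∈ antidiagonal (n + 1), (p.1 • (coeff p.1 f * coeff p.2 g)) +
      ∑ p ∈ antidiagonal (n + 1), (p.2 • (coeff p.1 f * coeff p.2 g)) := by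
    rw [Finset.smul_sum, ← Finset.sum_add_distrib]
    refine Finset.sum_congr rfl fun p hp => ?_
    rw [← add_smul, mem_antidiagonal.1 hp]
  -- In each sum the boundary term carries the factor `0`.
  rw [h1, Finset.Nat.sum_antidiagonal_succ, Finset.Nat.sum_antidiagonal_succ']
  simp [-nsmul_eq_mul]

theorem map_dot {A B : Type*} [Ring A] [Ring B] (φ : A →+* B) (f : A⟦X⟧) :
    PowerSeries.map φ (dot f) = dot (PowerSeries.map φ f) := by
  ext n
  simp [dot]

theorem commute_map {A B C : Type*} [Ring A] [Ring B] [Ring C] {φ : A →+* C} {ψ : B →+* C}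
    (h : ∀ a b, Commute (φ a) (ψ b)) (f : A⟦X⟧) (g : B⟦X⟧) :
    Commute (PowerSeries.map φ f) (PowerSeries.map ψ g) := by
  ext n
  rw [coeff_mul, coeff_mul, ← Finset.Nat.sum_antidiagonal_swap]
  exact Finset.sum_congr rfl fun p _ => by simpa using (h _ _).eq

variable (k : Type*) [CommRing k]

theorem ySeries_mul_rSeries : ySeries k * rSeries k = dot (ySeries k) := by
  rw [rSeries, ← mul_assoc, ySeries_mul_ySeriesInv, one_mul]

theorem lSeries_mul_ySeries : lSeries k * ySeries k = dot (ySeries k) := by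
  rw [lSeries, mul_assoc, ySeriesInv_mul_ySeries, mul_one]

@[simp] theorem y_zero : y k 0 = 1 := by simp [y]

theorem y_pnat (n : ℕ+) : y k n = FreeAlgebra.ι k n := dif_pos n.pos

theorem coproduct_y (n : ℕ) :
    coproduct k (y k n) = ∑ p ∈ antidiagonal n, y k p.1 ⊗ₜ[k] y k p.2 := by
  rcases n.eq_zero_or_pos with rfl | hn
  · simp [Algebra.TensorProduct.one_def]
  · lift n to ℕ+ using hn
    rw [y_pnat, coproduct, FreeAlgebra.lift_ι_apply,
      Finset.Nat.sum_antidiagonal_eq_sum_range_succ_mk, Finset.sum_range_succ,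
      Finset.range_eq_Ico, Finset.sum_eq_sum_Ico_succ_bot n.pos]
    simp only [y_zero, y_pnat, Nat.sub_zero, Nat.sub_self, zero_add]
    abel

/-- The inclusion of the left tensor factor. -/
abbrev inlHom : NCPoly k →+* NCPoly k ⊗[k] NCPoly k :=
  (Algebra.TensorProduct.includeLeft : NCPoly k →ₐ[k] NCPoly k ⊗[k] NCPoly k)

/-- The inclusion of the right tensor factor. -/
abbrev inrHom : NCPoly k →+* NCPoly k ⊗[k] NCPoly k :=
  (Algebra.TensorProduct.includeRight : NCPoly k →ₐ[k] NCPoly k ⊗[k] NCPoly k)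

theorem commute_inlHom_inrHom (a b : NCPoly k) : Commute (inlHom k a) (inrHom k b) := by
  simp [Commute, SemiconjBy]

/-- The generating series of the letters is group-like. -/
theorem map_coproduct_ySeries :
    PowerSeries.map (coproduct k : NCPoly k →+* NCPoly k ⊗[k] NCPoly k) (ySeries k) =
      PowerSeries.map (inlHom k) (ySeries k) * PowerSeries.map (inrHom k) (ySeries k) := by
  ext n
  simp [ySeries, coeff_mul, coproduct_y]

/-- Write `Δ𝒴 = 𝒴'𝒴''` with commuting tensor factors. Then `Δ𝒴 · ΔR = 𝒴'R'𝒴'' + 𝒴'𝒴''R'' = Δ𝒴 (R' +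
R'')`, and `Δ𝒴` is cancelled on the left. -/
theorem map_coproduct_rSeries :
    PowerSeries.map (coproduct k : NCPoly k →+* NCPoly k ⊗[k] NCPoly k) (rSeries k) =
      PowerSeries.map (inlHom k) (rSeries k) + PowerSeries.map (inrHom k) (rSeries k) := by
  set Δ := PowerSeries.map (coproduct k : NCPoly k →+* NCPoly k ⊗[k] NCPoly k)
  have hinv : Δ (ySeriesInv k) * Δ (ySeries k) = 1 := by
    rw [← map_mul, ySeriesInv_mul_ySeries, map_one]
  apply isLeftRegular_of_mul_eq_one hinv
  change Δ (ySeries k) * _ = Δ (ySeries k) * _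
  rw [← map_mul, ySeries_mul_rSeries, map_dot, map_coproduct_ySeries, dot_mul, ← map_dot,
    ← map_dot, ← ySeries_mul_rSeries, map_mul, map_mul, mul_add, mul_assoc, mul_assoc, mul_assoc,
    (commute_map (commute_inlHom_inrHom k) (rSeries k) (ySeries k)).eq]

theorem map_coproduct_lSeries :
    PowerSeries.map (coproduct k : NCPoly k →+* NCPoly k ⊗[k] NCPoly k) (lSeries k) =
      PowerSeries.map (inlHom k) (lSeries k) + PowerSeries.map (inrHom k) (lSeries k) := by
  set Δ := PowerSeries.map (coproduct k : NCPoly k →+* NCPoly k ⊗[k] NCPoly k)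
  have hinv : Δ (ySeries k) * Δ (ySeriesInv k) = 1 := by
    rw [← map_mul, ySeries_mul_ySeriesInv, map_one]
  apply isRightRegular_of_mul_eq_one hinv
  change _ * Δ (ySeries k) = _ * Δ (ySeries k)
  rw [← map_mul, lSeries_mul_ySeries, map_dot, map_coproduct_ySeries, dot_mul, ← map_dot,
    ← map_dot, ← lSeries_mul_ySeries, map_mul, map_mul, add_mul,
    ← mul_assoc (PowerSeries.map (inrHom k) (lSeries k)),
    ← (commute_map (commute_inlHom_inrHom k) (ySeries k) (lSeries k)).eq]
  simp only [mul_assoc]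

theorem isPrimitive_R (n : ℕ) : IsPrimitive k (R k n) := by
  simpa [IsPrimitive, R] using congrArg (coeff (n - 1)) (map_coproduct_rSeries k)

theorem isPrimitive_L (n : ℕ) : IsPrimitive k (L k n) := by
  simpa [IsPrimitive, L] using congrArg (coeff (n - 1)) (map_coproduct_lSeries k)

theorem nsmul_y_eq_sum_R (n : ℕ) :
    (n + 1) • y k (n + 1) = ∑ i ∈ Finset.range (n + 1), y k i * R k (n + 1 - i) := by
  have h := congrArg (coeff n) (ySeries_mul_rSeries k)
  rw [coeff_mul, Finset.Nat.sum_antidiagonal_eq_sum_range_succ_mk] at h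
  rw [dot, coeff_mk, ySeries, coeff_mk] at h
  rw [← h]
  refine Finset.sum_congr rfl fun i _ => ?_
  rw [coeff_mk, R, Nat.sub_right_comm, Nat.add_sub_cancel]

theorem nsmul_y_eq_sum_L (n : ℕ) :
    (n + 1) • y k (n + 1) = ∑ i ∈ Finset.range (n + 1), L k (n + 1 - i) * y k i := by
  have h := congrArg (coeff n) (lSeries_mul_ySeries k)
  rw [coeff_mul, ← Finset.Nat.sum_antidiagonal_swap,
    Finset.Nat.sum_antidiagonal_eq_sum_range_succ_mk] at h
  rw [dot, coeff_mk, ySeries, coeff_mk] at h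
  rw [← h]
  refine Finset.sum_congr rfl fun i _ => ?_
  simp only [Prod.swap, coeff_mk]
  rw [L, Nat.sub_right_comm, Nat.add_sub_cancel]

/-! ### Lie generation and expansion of the letters. -/

variable {k}

/-- A sequence of primitive elements that generates the algebra and is mapped to the letters by
an algebra morphism generates the Lie algebra of primitive elements. -/
theorem lieSpan_eq_Prim [Algebra ℚ k] {S : ℕ → NCPoly k}
    (hS : ∀ n, 1 ≤ n → IsPrimitive k (S n))
    (hgen : Algebra.adjoin k {P | ∃ n : ℕ, 1 ≤ n ∧ P = S n} = ⊤)
    (ψ : NCPoly k →ₐ[k] NCPoly k) (hψ : ∀ n, 1 ≤ n → ψ (S n) = y k n) :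
    LieSubalgebra.lieSpan k (NCPoly k) {P | ∃ n : ℕ, 1 ≤ n ∧ P = S n} = Prim k := by
  refine le_antisymm (LieSubalgebra.lieSpan_le.2 ?_) fun P hP => ?_
  · rintro _ ⟨n, hn, rfl⟩
    exact hS n hn
  have hψ' (n : ℕ+) : ψ (S n) = FreeAlgebra.ι k n := by rw [hψ n n.pos, y_pnat]
  let φ : NCPoly k →ₐ[k] NCPoly k := FreeAlgebra.lift k fun n : ℕ+ => S n
  have hφψ : φ.comp ψ = AlgHom.id k _ := by
    refine AlgHom.ext_of_adjoin_eq_top hgen ?_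
    rintro _ ⟨n, hn, rfl⟩
    obtain ⟨n, rfl⟩ : ∃ m : ℕ+, (m : ℕ) = n := ⟨⟨n, hn⟩, rfl⟩
    simp [φ, hψ']
  -- Both sides are algebra morphisms, so agreement on the generators `S n`, primitive with
  -- primitive images, suffices.
  have hcop : (FreeAlgebra.primitiveCoproduct k ℕ+).comp ψ =
      (Algebra.TensorProduct.map ψ ψ).comp (coproduct k) := by
    refine AlgHom.ext_of_adjoin_eq_top hgen ?_
    rintro _ ⟨n, hn, rfl⟩
    obtain ⟨n, rfl⟩ : ∃ m : ℕ+, (m : ℕ) = n := ⟨⟨n, hn⟩, rfl⟩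
    have h : coproduct k (S n) = _ := hS n hn
    simp [h, hψ']
  have hprim : FreeAlgebra.primitiveCoproduct k ℕ+ (ψ P) = ψ P ⊗ₜ[k] 1 + 1 ⊗ₜ[k] ψ P := by
    have hP' : coproduct k P = _ := hP
    have h := DFunLike.congr_fun hcop P
    simpa [hP'] using h
  have hle : LieSubalgebra.lieSpan k (NCPoly k) (Set.range (FreeAlgebra.ι k)) ≤
      (LieSubalgebra.lieSpan k (NCPoly k) {P | ∃ n : ℕ, 1 ≤ n ∧ P = S n}).comap φ.toLieHom := by
    refine LieSubalgebra.lieSpan_le.2 ?_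
    rintro _ ⟨n, rfl⟩
    exact LieSubalgebra.subset_lieSpan ⟨n, n.pos, by simp [φ]⟩
  have h : φ (ψ P) ∈ LieSubalgebra.lieSpan k (NCPoly k) {P | ∃ n : ℕ, 1 ≤ n ∧ P = S n} :=
    hle (FreeAlgebra.mem_lieSpan_of_primitive hprim)
  rwa [show φ (ψ P) = P from DFunLike.congr_fun hφψ P] at h

theorem adjoin_eq_top_of_y_mem {s : Set (NCPoly k)}
    (h : ∀ n, 1 ≤ n → y k n ∈ Algebra.adjoin k s) : Algebra.adjoin k s = ⊤ := by
  rw [eq_top_iff, ← FreeAlgebra.adjoin_range_ι, Algebra.adjoin_le_iff]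
  rintro _ ⟨n, rfl⟩
  exact y_pnat k n ▸ h n n.pos

variable [Algebra ℚ k]

theorem ratCast_smul_list_prod_mem {s : ℕ → NCPoly k} (c : ℚ) {l : List ℕ} (hl : ∀ i ∈ l, 1 ≤ i) :
    c • (l.map s).prod ∈ Algebra.adjoin k {P | ∃ n : ℕ, 1 ≤ n ∧ P = s n} := by
  rw [← algebraMap_smul k]
  refine Subalgebra.smul_mem _ (Subalgebra.list_prod_mem _ fun a ha => ?_) _
  obtain ⟨i, hi, rfl⟩ := List.mem_map.1 ha
  exact Algebra.subset_adjoin ⟨i, hl i hi, rfl⟩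

variable (k)

theorem y_eq_compSum_R (n : ℕ) : y k n = compSum (R k) n :=
  eq_compSum _ _ (y_zero k) (nsmul_y_eq_sum_R k) n

/-- In the opposite algebra the left recursion for `L` becomes the right recursion of `eq_compSum`.
-/
theorem y_eq_compSum_L (n : ℕ) :
    y k n = (compSum (fun i => MulOpposite.op (L k i)) n).unop := by
  refine MulOpposite.op_injective (eq_compSum _ (fun i => MulOpposite.op (y k i)) ?_ ?_ n)
  · simp
  · intro n
    rw [← MulOpposite.op_smul, nsmul_y_eq_sum_L]
    simp [Finset.op_sum]

theorem lieSpan_R :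
    LieSubalgebra.lieSpan k (NCPoly k) {P | ∃ n : ℕ, 1 ≤ n ∧ P = R k n} = Prim k := by
  -- This choice is forced: `yₙ` is `compSum` of the `R`'s, and `R` has to go to `y`.
  let ψ : NCPoly k →ₐ[k] NCPoly k := FreeAlgebra.lift k fun n : ℕ+ => compSum (y k) n
  have hψ (n : ℕ) : ψ (y k n) = compSum (y k) n := by
    rcases n.eq_zero_or_pos with rfl | hn
    · simp [compSum_zero]
    · lift n to ℕ+ using hn
      simp [y_pnat, ψ]
  refine lieSpan_eq_Prim (fun n _ => isPrimitive_R k n) (adjoin_eq_top_of_y_mem fun n _ => ?_) ψ ?_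
  · rw [y_eq_compSum_R]
    exact sum_mem fun J _ => ratCast_smul_list_prod_mem _ fun i => J.one_le_blocks
  · intro n hn
    -- `ψ(R)` and `y` satisfy the same recursion with `z = compSum y`: one is the image of the
    -- recursion for `R`, the other that of `compSum`.
    refine eq_of_recursion (S := fun n => ψ (R k n)) (compSum_zero (y k)) (fun n => ?_) hn
    rw [← natCast_smul_compSum_succ, ← hψ, ← map_nsmul, nsmul_y_eq_sum_R]
    simp [hψ]

theorem lieSpan_L :
    LieSubalgebra.lieSpan k (NCPoly k) {P | ∃ n : ℕ, 1 ≤ n ∧ P = L k n} = Prim k := by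
  set Z : ℕ → (NCPoly k)ᵐᵒᵖ := compSum fun i => MulOpposite.op (y k i) with hZ
  let ψ : NCPoly k →ₐ[k] NCPoly k := FreeAlgebra.lift k fun n : ℕ+ => (Z n).unop
  have hψ (n : ℕ) : MulOpposite.op (ψ (y k n)) = Z n := by
    rcases n.eq_zero_or_pos with rfl | hn
    · simp [hZ, compSum_zero]
    · lift n to ℕ+ using hn
      simp [y_pnat, ψ]
  refine lieSpan_eq_Prim (fun n _ => isPrimitive_L k n) (adjoin_eq_top_of_y_mem fun n _ => ?_) ψ ?_
  · rw [y_eq_compSum_L, unop_compSum_op]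
    exact sum_mem fun J _ => ratCast_smul_list_prod_mem _ fun i hi =>
      J.one_le_blocks (List.mem_reverse.1 hi)
  · intro n hn
    refine MulOpposite.op_injective (eq_of_recursion (S := fun n => MulOpposite.op (ψ (L k n)))
      (T := fun n => MulOpposite.op (y k n)) (z := Z) (compSum_zero _) (fun n => ?_) hn)
    rw [hZ, ← natCast_smul_compSum_succ, ← hZ, ← hψ, ← MulOpposite.op_smul, ← map_nsmul,
      nsmul_y_eq_sum_L]
    simp [← hψ, Finset.op_sum]

end

end Stuffle

theorem mainTheorem4 (k : Type*) [CommRing k] [Algebra ℚ k] :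
    -- the coefficients `R_n` and `L_n` are primitive
    ((∀ n : ℕ, 1 ≤ n → Stuffle.IsPrimitive k (Stuffle.R k n)) ∧
      (∀ n : ℕ, 1 ≤ n → Stuffle.IsPrimitive k (Stuffle.L k n))) ∧
    -- each family generates the Lie algebra of primitive elements
    (LieSubalgebra.lieSpan k (Stuffle.NCPoly k) {P | ∃ n : ℕ, 1 ≤ n ∧ P = Stuffle.R k n}
        = Stuffle.Prim k ∧
      LieSubalgebra.lieSpan k (Stuffle.NCPoly k) {P | ∃ n : ℕ, 1 ≤ n ∧ P = Stuffle.L k n}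
        = Stuffle.Prim k) ∧
    -- the triangular expansion of the letters in the `R`'s
    (∀ n : ℕ, 1 ≤ n →
      Stuffle.y k n
          = ∑ J : Composition n, ((Stuffle.piU J : ℚ)⁻¹) • Stuffle.compProd (Stuffle.R k) J ∧
      Stuffle.y k n
          = ((n : ℚ)⁻¹) • Stuffle.R k n
            + ∑ J : Composition n with 1 < J.length,
                ((Stuffle.piU J : ℚ)⁻¹) • Stuffle.compProd (Stuffle.R k) J) ∧
    -- the mirror expansion in the `L`'s
    (∀ n : ℕ, 1 ≤ n →
      Stuffle.y k n
          = ∑ J : Composition n,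
              ((Stuffle.piU J : ℚ)⁻¹) • Stuffle.compProdMirror (Stuffle.L k) J ∧
      Stuffle.y k n
          = ((n : ℚ)⁻¹) • Stuffle.L k n
            + ∑ J : Composition n with 1 < J.length,
                ((Stuffle.piU J : ℚ)⁻¹) • Stuffle.compProdMirror (Stuffle.L k) J) := by
  refine ⟨⟨fun n _ => Stuffle.isPrimitive_R k n, fun n _ => Stuffle.isPrimitive_L k n⟩,
    ⟨Stuffle.lieSpan_R k, Stuffle.lieSpan_L k⟩, fun n hn => ⟨Stuffle.y_eq_compSum_R k n, ?_⟩,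
    fun n hn => ⟨?_, ?_⟩⟩
  · rw [Stuffle.y_eq_compSum_R, Stuffle.compSum_eq_add _ hn]
  · rw [Stuffle.y_eq_compSum_L, Stuffle.unop_compSum_op]
  · rw [Stuffle.y_eq_compSum_L, Stuffle.compSum_eq_add _ hn]
    simp [← Stuffle.unop_compProd_op, Finset.unop_sum]
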